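/- **Setting.** There are $N$ agents and $M$ stochastic bandits with $K$ arms each. An instance $\nu=(\mu,c)$ consists of arm means $\mu_{m,k}\in\mathbb{R}$ such that every bandit $m$ has a unique best arm $k^*(m)$ (i.e. $\mu_{m,k^*(m)}>\mu_{m,k}$ for all $k\neq k^*(m)$), and of a map $c:[N]\to[M]$, where $c(i)$ is the bandit that agent $i$ is learning (equivalently, the partition $\mathcal I_m=c^{-1}(m)$). Put $\Delta_{m,k}=\mu_{m,k^*(m)}-\mu_{m,k}$. In each round $t=1,2,\dots$ every agent $i$ pulls an arm $I^{(i)}_t\in[K]$ and receives a reward which, given everything that happened before and the arms pulled in the round, is distributed as $\mathcal N(\mu_{c(i),I_t^{(i)}},1)$, independently over the agents. Between the pulls the agents may communicate. A policy fixes (possibly depending on the horizon $T$ and on $c$, but not on $\mu$) the joint law of the communication and arm pulls of each round given the arms, rewards and communications of all previous rounds. The communication is unrestricted; in particular all decentralized policies are included in which an agent uses only its own past arms, rewards and received messages, with gossip pulls of a limited number of bits, whether the agents do not know who else learns the same bandit or know some of these agents. The group regret is $\mathrm{Reg}(T)=\sum_{i=1}^N\sum_{t=1}^T\Delta_{c(i),I^{(i)}_t}$.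 Let $J\subseteq\mathbb R$ be an interval (for instance $J=[0,1]$ or $J=\mathbb R$) and let $\mathcal A$ be a set of maps $[N]\to[M]$ (for instance those with $c_1N/M\le|c^{-1}(m)|\le c_2N/M$ for all $m$, for given constants $c_1,c_2$). A policy is called uniformly efficient if $\mathbb E_{\nu}[\mathrm{Reg}(T)]=o(T^\gamma)$ as $T\to\infty$ for every $\gamma\in(0,1)$ and every instance $\nu=(\mu,c)$ with all $\mu_{m,k}\in J$ and $c\in\mathcal A$. **Theorem.** For any uniformly efficient policy and any instance $\nu=(\mu,c)$ with all $\mu_{m,k}\in J$ and $c\in\mathcal A$, such that every bandit is learnt by at least one agent and no best mean $\mu_{m,k^*(m)}$ is the largest element of $J$, $$\liminf_{T\to\infty}\frac{\mathbb E_{\nu}[\mathrm{Reg}(T)]}{\log T}\ \ge\ \sum_{m\in[M]}\ \sum_{k\in[K]\setminus\{k^*(m)\}}\frac{2}{\Delta_{m,k}}.$$ -/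

import Mathlib

open MeasureTheory ProbabilityTheory Filter Topology Asymptotics

namespace GroupBandit

/-- A problem instance for `N` agents, `M` bandits and `K` arms: the mean rewards of the arms of
each bandit, the assignment of agents to bandits (equivalently the partition of the agents into
the sets `{i | assign i = m}`), and the best arm of each bandit, which is its unique maximizer. -/
structure BanditInstance (N M K : ℕ) where
  /-- `mean m k` is the mean reward of arm `k` of bandit `m`. -/
  mean : Fin M → Fin K → ℝ
  /-- `assign i` is the bandit that agent `i` is learning. -/
  assign : Fin N → Fin M
  /-- `best m` is the best arm of bandit `m`. -/
  best : Fin M → Fin K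
  best_lt : ∀ m k, k ≠ best m → mean m k < mean m (best m)

namespace BanditInstance

variable {N M K : ℕ}

/-- The arm gap of arm `k` of bandit `m`. -/
def gap (ν : BanditInstance N M K) (m : Fin M) (k : Fin K) : ℝ :=
  ν.mean m (ν.best m) - ν.mean m k

/-- The joint law of the rewards that the agents receive in one round, as a function of the arms
`a i` that they pull: independent Gaussians of unit variance, the one of agent `i` having the mean
of arm `a i` of the bandit of agent `i`. -/
noncomputable def rewardKernel (ν : BanditInstance N M K) :
    Kernel (Fin N → Fin K) (Fin N → ℝ) :=
  Kernel.ofFunOfCountable fun a =>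
    Measure.pi fun i => gaussianReal (ν.mean (ν.assign i) (a i)) 1

instance (ν : BanditInstance N M K) : IsMarkovKernel ν.rewardKernel :=
  ⟨fun a => inferInstanceAs
    (IsProbabilityMeasure (Measure.pi fun i => gaussianReal (ν.mean (ν.assign i) (a i)) 1))⟩

end BanditInstance

/-- The record of one round: a communication record in `𝓜` (all messages exchanged in that round,
who contacted whom, and the outcomes of all internal randomizations), the arms pulled by the
agents, and the rewards received by the agents. -/
abbrev Round (N K : ℕ) (𝓜 : Type*) : Type _ := (𝓜 × (Fin N → Fin K)) × (Fin N → ℝ)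

/-- A joint strategy of the `N` agents. Given the records of the rounds `0, …, t - 1`, the
communication record of round `t` and the arms pulled in round `t` have the joint law
`act t history`. No constraint is put on the communication: it may use any network, any random
contacts, any number of bits, and private or shared randomness. A decentralized strategy, in which
each agent uses only its own past arms, rewards and received messages, is one whose kernels `act t`
factorize accordingly, whatever the communication protocol. -/
structure Strategy (N K : ℕ) (𝓜 : Type*) [MeasurableSpace 𝓜] where
  act : (t : ℕ) → Kernel (Fin t → Round N K 𝓜) (𝓜 × (Fin N → Fin K))
  markov : ∀ t, IsMarkovKernel (act t)

instance {N K : ℕ} {𝓜 : Type*} [MeasurableSpace 𝓜] (s : Strategy N K 𝓜) (t : ℕ) :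
    IsMarkovKernel (s.act t) := s.markov t

/-- A policy gives a strategy for each horizon `T` and each assignment `c` of the agents to the
bandits. It does not know the means. Agents that do not know who learns which bandit follow a
policy that is constant in `c`; if each agent knows some of the agents that learn the same bandit,
the strategy depends on `c` through that knowledge. An anytime policy is constant in `T`. -/
abbrev Policy (N M K : ℕ) (𝓜 : Type*) [MeasurableSpace 𝓜] : Type _ :=
  (T : ℕ) → (c : Fin N → Fin M) → Strategy N K 𝓜

section Law

variable {N M K : ℕ} {𝓜 : Type*} [MeasurableSpace 𝓜]

/-- The conditional law of the record of round `t` given the records of the earlier rounds. -/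
noncomputable def stepKernel (s : Strategy N K 𝓜) (ν : BanditInstance N M K) (t : ℕ) :
    Kernel (Fin t → Round N K 𝓜) (Round N K 𝓜) :=
  s.act t ⊗ₖ ν.rewardKernel.comap (fun p => p.2.2) (measurable_snd.comp measurable_snd)

instance (s : Strategy N K 𝓜) (ν : BanditInstance N M K) (t : ℕ) :
    IsMarkovKernel (stepKernel s ν t) := by
  unfold stepKernel; infer_instance

/-- Append the record of one more round to a history. -/
def extend {t : ℕ} (p : (Fin t → Round N K 𝓜) × Round N K 𝓜) : Fin (t + 1) → Round N K 𝓜 :=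
  Fin.snoc (α := fun _ => Round N K 𝓜) p.1 p.2

/-- The law of the records of the first `t` rounds when the agents use the strategy `s` on the
instance `ν`. -/
noncomputable def law (s : Strategy N K 𝓜) (ν : BanditInstance N M K) :
    (t : ℕ) → Measure (Fin t → Round N K 𝓜)
  | 0 => Measure.dirac Fin.elim0
  | t + 1 => (law s ν t ⊗ₘ stepKernel s ν t).map extend

theorem measurable_extend {t : ℕ} :
    Measurable (extend : (Fin t → Round N K 𝓜) × Round N K 𝓜 → Fin (t + 1) → Round N K 𝓜) := by
  refine measurable_pi_lambda _ fun i => ?_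
  refine Fin.lastCases ?_ (fun j => ?_) i
  · simpa [extend] using measurable_snd
  · simpa [extend, Function.comp_def] using
      (measurable_pi_apply (X := fun _ : Fin t => Round N K 𝓜) j).comp measurable_fst

instance (s : Strategy N K 𝓜) (ν : BanditInstance N M K) (t : ℕ) :
    IsProbabilityMeasure (law s ν t) := by
  induction t with
  | zero => unfold law; infer_instance
  | succ t ih => unfold law; exact Measure.isProbabilityMeasure_map measurable_extend.aemeasurable

/-- The group regret of a history of `T` rounds: the sum over all agents and all rounds of the gap
of the arm that the agent pulled in that round. -/
def groupRegret (ν : BanditInstance N M K) {T : ℕ} (h : Fin T → Round N K 𝓜) : ℝ :=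
  ∑ i : Fin N, ∑ t : Fin T, ν.gap (ν.assign i) ((h t).1.2 i)

/-- The expected group regret after `T` rounds. The integrand takes finitely many values. -/
noncomputable def expectedRegret (π : Policy N M K 𝓜) (ν : BanditInstance N M K) (T : ℕ) : ℝ :=
  ∫ h, groupRegret ν h ∂(law (π T ν.assign) ν T)

end Law

/-- The instances whose means lie in `J` (typically `J = [0, 1]`) and whose assignment of agents to
bandits lies in `𝒜` (typically the assignments such that each bandit is learnt by between
`c₁ * N / M` and `c₂ * N / M` agents). -/
def problemClass {N M K : ℕ} (J : Set ℝ) (𝒜 : Set (Fin N → Fin M)) :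
    Set (BanditInstance N M K) :=
  {ν | (∀ m k, ν.mean m k ∈ J) ∧ ν.assign ∈ 𝒜}

/-- Uniform efficiency: the expected group regret is `o(T ^ γ)` for all `γ ∈ (0, 1)` and on every
instance of the problem class. -/
def UniformlyEfficient {N M K : ℕ} {𝓜 : Type*} [MeasurableSpace 𝓜]
    (J : Set ℝ) (𝒜 : Set (Fin N → Fin M)) (π : Policy N M K 𝓜) : Prop :=
  ∀ ν ∈ problemClass (K := K) J 𝒜, ∀ γ : ℝ, 0 < γ → γ < 1 →
    (fun T : ℕ => expectedRegret π ν T) =o[atTop] (fun T : ℕ => (T : ℝ) ^ γ)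

end GroupBandit

/-!
The bound follows the change-of-measure argument of Lai and Robbins, applied to the group of agents
as a single learner. Fix a bandit `m` and a suboptimal arm `k` with gap `Δ`, and compare `ν` with
the instance on which arm `k` of bandit `m` is raised to a mean exceeding the best one by a small
`ε` (`BanditInstance.raiseArm`). It stays in the problem class since the best mean is not the
largest element of the interval `J`.

Communication and arm choices have the same conditional law on both instances, so the log-likelihood
ratio `L` of the history only collects the rewards (`lintegral_law_change`), and its expectation is
the expected number of pulls of arm `k` by all agents of bandit `m`, times `(Δ + ε) ^ 2 / 2`
(`integral_sum_roundLogRatio`, `roundInfo_raiseArm`). A testing inequality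
(`exp_neg_le_testing_error`) says that a small expectation of `L` leaves the two instances hard to
tell apart. But a policy with small regret tells them apart: it rarely pulls arm `k` half of the
`T` times on `ν`, and on the raised instance it nearly always does, already through one agent.
This gives `exp_neg_pulls_le_regret`, and with regret `o(T ^ ε)` on both instances at least about
`2 / (Δ + ε) ^ 2 * log T` pulls (`eventually_expectedPulls_ge`). Since `ε` is arbitrary and the
regret is the sum of the gaps times the numbers of pulls
(`expectedRegret_eq_sum_expectedPulls`), the theorem follows.
-/

/-! ### Change of measure for Gaussian products -/

namespace GroupBandit

/-- The log-likelihood ratio `log (dN(a, 1) / dN(b, 1))` at `x`. -/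
noncomputable def gaussianLogRatio (a b x : ℝ) : ℝ := ((x - b) ^ 2 - (x - a) ^ 2) / 2

theorem measurable_gaussianLogRatio (a b : ℝ) : Measurable (gaussianLogRatio a b) := by
  unfold gaussianLogRatio; fun_prop

theorem measurable_exp_neg_gaussianLogRatio (a b : ℝ) :
    Measurable fun x => ENNReal.ofReal (Real.exp (-gaussianLogRatio a b x)) :=
  (measurable_gaussianLogRatio a b).neg.exp.ennreal_ofReal

theorem gaussianLogRatio_eq (a b x : ℝ) :
    gaussianLogRatio a b x = (a - b) * x + (b ^ 2 - a ^ 2) / 2 := by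
  unfold gaussianLogRatio; ring

theorem integrable_gaussianLogRatio (a b : ℝ) :
    Integrable (gaussianLogRatio a b) (gaussianReal a 1) := by
  have h : Integrable (fun x : ℝ => x) (gaussianReal a 1) :=
    (memLp_id_gaussianReal (μ := a) (v := 1) 1).integrable (by simp)
  rw [funext (gaussianLogRatio_eq a b)]
  exact (h.const_mul (a - b)).add (integrable_const ((b ^ 2 - a ^ 2) / 2))

theorem integral_gaussianLogRatio (a b : ℝ) :
    ∫ x, gaussianLogRatio a b x ∂gaussianReal a 1 = (a - b) ^ 2 / 2 := by
  have h : Integrable (fun x : ℝ => x) (gaussianReal a 1) :=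
    (memLp_id_gaussianReal (μ := a) (v := 1) 1).integrable (by simp)
  simp only [gaussianLogRatio_eq]
  rw [integral_add (h.const_mul (a - b)) (integrable_const _), integral_const_mul,
    integral_id_gaussianReal]
  simp
  ring

theorem gaussianReal_eq_withDensity (a b : ℝ) :
    gaussianReal b 1 = (gaussianReal a 1).withDensity
      fun x => ENNReal.ofReal (Real.exp (-gaussianLogRatio a b x)) := by
  rw [gaussianReal_of_var_ne_zero b one_ne_zero, gaussianReal_of_var_ne_zero a one_ne_zero,
    ← withDensity_mul _ (measurable_gaussianPDF a 1)
      (measurable_exp_neg_gaussianLogRatio a b)]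
  congr 1
  ext x
  rw [Pi.mul_apply, gaussianPDF, gaussianPDF,
    ← ENNReal.ofReal_mul (gaussianPDFReal_nonneg _ _ _), gaussianPDFReal, gaussianPDFReal,
    mul_assoc (√_)⁻¹, ← Real.exp_add]
  congr 3
  simp [gaussianLogRatio]
  ring

/-- A product of densities is a density of the product measure. -/
theorem pi_withDensity_eq {ι : Type*} [Fintype ι] (P : ι → Measure ℝ)
    [∀ i, IsProbabilityMeasure (P i)] (f : ι → ℝ → ENNReal) (hf : ∀ i, Measurable (f i))
    [∀ i, IsProbabilityMeasure ((P i).withDensity (f i))] :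
    Measure.pi (fun i => (P i).withDensity (f i)) =
      (Measure.pi P).withDensity fun x => ∏ i, f i (x i) := by
  refine Measure.pi_eq fun s hs => ?_
  have hg : ∀ i, Measurable ((s i).indicator (f i)) := fun i => (hf i).indicator (hs i)
  have hind : iIndepFun (fun i (x : ι → ℝ) => (s i).indicator (f i) (x i)) (Measure.pi P) :=
    iIndepFun_pi fun i => (hg i).aemeasurable
  have hprod := lintegral_prod_eq_prod_lintegral_of_indepFun Finset.univ _ hind
    fun i => (hg i).comp (measurable_pi_apply i)
  rw [withDensity_apply _ (MeasurableSet.univ_pi hs),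
    ← lintegral_indicator (MeasurableSet.univ_pi hs)]
  calc ∫⁻ x, (Set.univ.pi s).indicator (fun x => ∏ i, f i (x i)) x ∂Measure.pi P
      = ∫⁻ x, ∏ i, (s i).indicator (f i) (x i) ∂Measure.pi P := by
        refine lintegral_congr fun x => ?_
        by_cases hx : x ∈ Set.univ.pi s
        · rw [Set.indicator_of_mem hx]
          exact Finset.prod_congr rfl fun i _ =>
            (Set.indicator_of_mem (hx i (Set.mem_univ i)) (f i)).symm
        · rw [Set.indicator_of_notMem hx]
          simp only [Set.mem_univ_pi, not_forall] at hx
          obtain ⟨i, hi⟩ := hx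
          exact (Finset.prod_eq_zero (Finset.mem_univ i) (Set.indicator_of_notMem hi _)).symm
    _ = ∏ i, ∫⁻ x, (s i).indicator (f i) (x i) ∂Measure.pi P := hprod
    _ = ∏ i, (P i).withDensity (f i) (s i) := by
        refine Finset.prod_congr rfl fun i _ => ?_
        rw [withDensity_apply _ (hs i), ← lintegral_indicator (hs i),
          (measurePreserving_eval P i).lintegral_comp (hg i)]

variable {N M K : ℕ} {𝓜 : Type*}

/-- The log-likelihood ratio of the instance `ν` against the instance `ν'` for the record of one
round. The law of the messages and arms given the past is the same for both instances, so only the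
rewards contribute. -/
noncomputable def roundLogRatio (ν ν' : BanditInstance N M K) (r : Round N K 𝓜) : ℝ :=
  ∑ i, gaussianLogRatio (ν.mean (ν.assign i) (r.1.2 i)) (ν'.mean (ν'.assign i) (r.1.2 i)) (r.2 i)

/-- The information that one round with arms `a` gives for telling `ν` from `ν'`: the
Kullback-Leibler divergence of the reward laws. -/
noncomputable def roundInfo (ν ν' : BanditInstance N M K) (a : Fin N → Fin K) : ℝ :=
  ∑ i, (ν.mean (ν.assign i) (a i) - ν'.mean (ν'.assign i) (a i)) ^ 2 / 2

/-- Measurability in the arms and the rewards, the arms ranging over a countable type. -/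
theorem measurable_of_arms [MeasurableSpace 𝓜] {β : Type*} [MeasurableSpace β]
    {f : (Fin N → Fin K) → (Fin N → ℝ) → β} (hf : ∀ a, Measurable (f a)) :
    Measurable fun r : Round N K 𝓜 => f r.1.2 r.2 :=
  (measurable_from_prod_countable_right (f := Function.uncurry f) hf).comp
    ((measurable_snd.comp measurable_fst).prodMk measurable_snd)

theorem measurable_roundLogRatio [MeasurableSpace 𝓜] (ν ν' : BanditInstance N M K) :
    Measurable (roundLogRatio (𝓜 := 𝓜) ν ν') :=
  measurable_of_arms (f := fun a x => ∑ i, gaussianLogRatio (ν.mean (ν.assign i) (a i))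
    (ν'.mean (ν'.assign i) (a i)) (x i)) fun _ => Finset.measurable_fun_sum _ fun i _ =>
      (measurable_gaussianLogRatio _ _).comp (measurable_pi_apply i)

theorem rewardKernel_apply (ν : BanditInstance N M K) (a : Fin N → Fin K) :
    ν.rewardKernel a = Measure.pi fun i => gaussianReal (ν.mean (ν.assign i) (a i)) 1 := rfl

theorem rewardKernel_eq_withDensity (ν ν' : BanditInstance N M K) (q : 𝓜 × (Fin N → Fin K)) :
    ν'.rewardKernel q.2 = (ν.rewardKernel q.2).withDensity
      fun x => ENNReal.ofReal (Real.exp (-roundLogRatio ν ν' (q, x))) := by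
  have h := fun i => gaussianReal_eq_withDensity (ν.mean (ν.assign i) (q.2 i))
    (ν'.mean (ν'.assign i) (q.2 i))
  have hprob : ∀ i, IsProbabilityMeasure ((gaussianReal (ν.mean (ν.assign i) (q.2 i)) 1).withDensity
      fun x => ENNReal.ofReal (Real.exp (-gaussianLogRatio (ν.mean (ν.assign i) (q.2 i))
        (ν'.mean (ν'.assign i) (q.2 i)) x))) := fun i => by rw [← h i]; infer_instance
  rw [rewardKernel_apply, rewardKernel_apply, funext h, pi_withDensity_eq _ _ fun i =>
    measurable_exp_neg_gaussianLogRatio _ _]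
  congr 1
  ext x
  rw [← ENNReal.ofReal_prod_of_nonneg fun i _ => (Real.exp_pos _).le, ← Real.exp_sum,
    Finset.sum_neg_distrib]
  rfl

theorem integrable_gaussianLogRatio_eval (ν ν' : BanditInstance N M K) (a : Fin N → Fin K)
    (i : Fin N) : Integrable (fun x : Fin N → ℝ => gaussianLogRatio (ν.mean (ν.assign i) (a i))
      (ν'.mean (ν'.assign i) (a i)) (x i)) (ν.rewardKernel a) :=
  integrable_comp_eval (μ := fun i => gaussianReal (ν.mean (ν.assign i) (a i)) 1)
    (integrable_gaussianLogRatio _ _)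

theorem integrable_roundLogRatio (ν ν' : BanditInstance N M K) (q : 𝓜 × (Fin N → Fin K)) :
    Integrable (fun x => roundLogRatio ν ν' (q, x)) (ν.rewardKernel q.2) :=
  integrable_finsetSum _ fun i _ => integrable_gaussianLogRatio_eval ν ν' q.2 i

theorem integral_roundLogRatio (ν ν' : BanditInstance N M K) (q : 𝓜 × (Fin N → Fin K)) :
    ∫ x, roundLogRatio ν ν' (q, x) ∂ν.rewardKernel q.2 = roundInfo ν ν' q.2 := by
  unfold roundLogRatio
  refine (integral_finsetSum _ fun i _ => integrable_gaussianLogRatio_eval ν ν' q.2 i).trans ?_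
  refine Finset.sum_congr rfl fun i _ => ?_
  exact (integral_comp_eval (μ := fun i => gaussianReal (ν.mean (ν.assign i) (q.2 i)) 1)
    (integrable_gaussianLogRatio _ _).aestronglyMeasurable).trans (integral_gaussianLogRatio _ _)

end GroupBandit

/-! ### The laws of histories -/

namespace GroupBandit

variable {N M K : ℕ} {𝓜 : Type*}

theorem sum_extend {t : ℕ} (g : Round N K 𝓜 → ℝ)
    (p : (Fin t → Round N K 𝓜) × Round N K 𝓜) :
    ∑ u, g (extend p u) = ∑ u, g (p.1 u) + g p.2 := by
  rw [Fin.sum_univ_castSucc]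
  simp [extend]

variable [MeasurableSpace 𝓜]

theorem lintegral_stepKernel (s : Strategy N K 𝓜) (ν : BanditInstance N M K) {t : ℕ}
    (h : Fin t → Round N K 𝓜) {f : Round N K 𝓜 → ENNReal} (hf : Measurable f) :
    ∫⁻ r, f r ∂stepKernel s ν t h =
      ∫⁻ q, ∫⁻ x, f (q, x) ∂ν.rewardKernel q.2 ∂s.act t h := by
  unfold stepKernel
  rw [Kernel.lintegral_compProd _ _ _ hf]
  rfl

theorem lintegral_law_succ (s : Strategy N K 𝓜) (ν : BanditInstance N M K) {t : ℕ}
    {f : (Fin (t + 1) → Round N K 𝓜) → ENNReal} (hf : Measurable f) :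
    ∫⁻ h, f h ∂law s ν (t + 1) =
      ∫⁻ h, ∫⁻ r, f (extend (h, r)) ∂stepKernel s ν t h ∂law s ν t := by
  rw [law, lintegral_map hf measurable_extend,
    Measure.lintegral_compProd (hf.fun_comp measurable_extend)]

theorem measurable_sum_rounds {t : ℕ} {g : Round N K 𝓜 → ℝ} (hg : Measurable g) :
    Measurable fun h : Fin t → Round N K 𝓜 => ∑ u, g (h u) :=
  Finset.measurable_fun_sum _ fun u _ => hg.comp (measurable_pi_apply u)

/-- Change of measure for one round. -/
theorem lintegral_stepKernel_change (s : Strategy N K 𝓜) (ν ν' : BanditInstance N M K) {t : ℕ}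
    (h : Fin t → Round N K 𝓜) {f : Round N K 𝓜 → ENNReal} (hf : Measurable f) :
    ∫⁻ r, f r ∂stepKernel s ν' t h = ∫⁻ r,
      ENNReal.ofReal (Real.exp (-roundLogRatio ν ν' r)) * f r ∂stepKernel s ν t h := by
  have hd : Measurable fun r : Round N K 𝓜 => ENNReal.ofReal (Real.exp (-roundLogRatio ν ν' r)) :=
    (measurable_roundLogRatio ν ν').neg.exp.ennreal_ofReal
  rw [lintegral_stepKernel s ν' h hf, lintegral_stepKernel s ν h (hd.fun_mul hf)]
  refine lintegral_congr fun q => ?_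
  rw [rewardKernel_eq_withDensity ν ν' q, lintegral_withDensity_eq_lintegral_mul _
    (hd.fun_comp measurable_prodMk_left) (hf.fun_comp measurable_prodMk_left)]
  rfl

/-- Change of measure: under the same strategy, the law of the history on `ν'` has density
`exp (-L)` with respect to its law on `ν`, where `L` is the sum of the log-likelihood ratios of the
rounds. -/
theorem lintegral_law_change (s : Strategy N K 𝓜) (ν ν' : BanditInstance N M K) (t : ℕ) :
    ∀ {f : (Fin t → Round N K 𝓜) → ENNReal}, Measurable f →
      ∫⁻ h, f h ∂law s ν' t =
        ∫⁻ h, ENNReal.ofReal (Real.exp (-∑ u, roundLogRatio ν ν' (h u))) * f h ∂law s ν t := by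
  induction t with
  | zero => intro f _; simp [law]
  | succ t ih =>
    intro f hf
    have hd : Measurable fun r : Round N K 𝓜 =>
        ENNReal.ofReal (Real.exp (-roundLogRatio ν ν' r)) :=
      (measurable_roundLogRatio ν ν').neg.exp.ennreal_ofReal
    have hfe : Measurable fun p : (Fin t → Round N K 𝓜) × Round N K 𝓜 => f (extend p) :=
      hf.comp measurable_extend
    have hmul : Measurable fun h : Fin (t + 1) → Round N K 𝓜 =>
        ENNReal.ofReal (Real.exp (-∑ u, roundLogRatio ν ν' (h u))) * f h :=
      (measurable_sum_rounds (measurable_roundLogRatio ν ν')).neg.exp.ennreal_ofReal.mul hf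
    have hinner : Measurable fun h : Fin t → Round N K 𝓜 =>
        ∫⁻ r, f (extend (h, r)) ∂stepKernel s ν' t h :=
      Measurable.lintegral_kernel_prod_right' hfe
    rw [lintegral_law_succ s ν' hf, lintegral_law_succ s ν hmul, ih hinner]
    refine lintegral_congr fun h => ?_
    have hfh : Measurable fun r => f (extend (h, r)) := hfe.comp measurable_prodMk_left
    rw [lintegral_stepKernel_change s ν ν' h hfh, ← lintegral_const_mul _ (hd.fun_mul hfh)]
    refine lintegral_congr fun r => ?_
    rw [sum_extend, neg_add, Real.exp_add, ENNReal.ofReal_mul (Real.exp_pos _).le, mul_assoc]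

/-- A sum over the rounds of increments that are centred given the past is centred. -/
theorem integral_sum_rounds_eq_zero (s : Strategy N K 𝓜) (ν : BanditInstance N M K)
    {g : Round N K 𝓜 → ℝ} (hg : Measurable g)
    {C : ENNReal} (hC : C ≠ ⊤)
    (hbound : ∀ t (h : Fin t → Round N K 𝓜), ∫⁻ r, ‖g r‖ₑ ∂stepKernel s ν t h ≤ C)
    (hzero : ∀ t (h : Fin t → Round N K 𝓜), ∫ r, g r ∂stepKernel s ν t h = 0) (t : ℕ) :
    Integrable (fun h => ∑ u, g (h u)) (law s ν t) ∧ ∫ h, ∑ u, g (h u) ∂law s ν t = 0 := by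
  induction t with
  | zero => simp
  | succ t ih =>
    have h1 : Integrable (fun p : (Fin t → Round N K 𝓜) × Round N K 𝓜 => ∑ u, g (p.1 u))
        (law s ν t ⊗ₘ stepKernel s ν t) := by
      have h0 : Integrable (fun h => ∑ u, g (h u)) ((law s ν t ⊗ₘ stepKernel s ν t).map Prod.fst) := by
        have := Measure.fst_compProd (law s ν t) (stepKernel s ν t)
        rw [Measure.fst] at this
        rw [this]; exact ih.1
      exact h0.comp_measurable measurable_fst
    have h2 : Integrable (fun p : (Fin t → Round N K 𝓜) × Round N K 𝓜 => g p.2)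
        (law s ν t ⊗ₘ stepKernel s ν t) := by
      refine ⟨(hg.comp measurable_snd).aestronglyMeasurable, ?_⟩
      rw [HasFiniteIntegral, Measure.lintegral_compProd (hg.fun_comp measurable_snd).enorm]
      refine (lintegral_mono fun h => hbound t h).trans_lt ?_
      simpa using hC.lt_top
    have hm := measurable_sum_rounds (t := t + 1) hg
    have e : (fun p : (Fin t → Round N K 𝓜) × Round N K 𝓜 => ∑ u, g (extend p u)) =
        fun p => ∑ u, g (p.1 u) + g p.2 := funext fun p => sum_extend g p
    rw [law]
    refine ⟨?_, ?_⟩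
    · rw [integrable_map_measure hm.aestronglyMeasurable measurable_extend.aemeasurable]
      exact (h1.add h2).congr (ae_of_all _ fun p => (sum_extend g p).symm)
    · rw [integral_map measurable_extend.aemeasurable hm.aestronglyMeasurable, e,
        integral_add h1 h2, Measure.integral_compProd h1, Measure.integral_compProd h2]
      simp [hzero, ih.2]

theorem measurable_arms {β : Type*} [MeasurableSpace β] (g : (Fin N → Fin K) → β) :
    Measurable fun r : Round N K 𝓜 => g r.1.2 :=
  measurable_of_arms (f := fun a _ => g a) fun _ => measurable_const

theorem integrable_sum_arms (s : Strategy N K 𝓜) (ν : BanditInstance N M K) (t : ℕ)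
    (g : (Fin N → Fin K) → ℝ) :
    Integrable (fun h : Fin t → Round N K 𝓜 => ∑ u, g (h u).1.2) (law s ν t) := by
  refine integrable_finsetSum _ fun u _ => ?_
  refine Integrable.of_bound (C := ∑ a, ‖g a‖)
    ((measurable_arms g).comp (measurable_pi_apply u)).aestronglyMeasurable ?_
  exact ae_of_all _ fun h =>
    Finset.single_le_sum (f := fun a => ‖g a‖) (fun _ _ => norm_nonneg _) (Finset.mem_univ _)

/-- The divergence decomposition: the expected log-likelihood ratio of the history is the expected
sum of the information of the rounds. -/
theorem integral_sum_roundLogRatio (s : Strategy N K 𝓜) (ν ν' : BanditInstance N M K) (t : ℕ) :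
    Integrable (fun h => ∑ u, roundLogRatio ν ν' (h u)) (law s ν t) ∧
      ∫ h, ∑ u, roundLogRatio ν ν' (h u) ∂law s ν t =
        ∫ h, ∑ u, roundInfo ν ν' (h u).1.2 ∂law s ν t := by
  set g : Round N K 𝓜 → ℝ := fun r => roundLogRatio ν ν' r - roundInfo ν ν' r.1.2 with hg_def
  have hg : Measurable g := (measurable_roundLogRatio ν ν').sub (measurable_arms _)
  set B : (Fin N → Fin K) → ENNReal := fun a =>
    ∫⁻ x, ‖∑ i, gaussianLogRatio (ν.mean (ν.assign i) (a i)) (ν'.mean (ν'.assign i) (a i)) (x i)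
      - roundInfo ν ν' a‖ₑ ∂ν.rewardKernel a with hB
  have hBq : ∀ q : 𝓜 × (Fin N → Fin K), ∫⁻ x, ‖g (q, x)‖ₑ ∂ν.rewardKernel q.2 = B q.2 :=
    fun q => rfl
  have hbound : ∀ u (h : Fin u → Round N K 𝓜),
      ∫⁻ r, ‖g r‖ₑ ∂stepKernel s ν u h ≤ ∑ a, B a := by
    intro u h
    rw [lintegral_stepKernel s ν h hg.enorm]
    calc ∫⁻ q, ∫⁻ x, ‖g (q, x)‖ₑ ∂ν.rewardKernel q.2 ∂s.act u h
        ≤ ∫⁻ _, ∑ a, B a ∂s.act u h := lintegral_mono fun q => by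
          rw [hBq]; exact Finset.single_le_sum (fun _ _ => zero_le) (Finset.mem_univ _)
      _ = ∑ a, B a := by simp
  have hC : ∑ a, B a ≠ ⊤ := by
    refine (ENNReal.sum_lt_top.2 fun a _ => ?_).ne
    exact ((integrable_roundLogRatio (𝓜 := Unit) ν ν' ((), a)).sub
      (integrable_const (roundInfo ν ν' a))).hasFiniteIntegral
  have hint : ∀ u (h : Fin u → Round N K 𝓜), Integrable g (stepKernel s ν u h) := fun u h =>
    ⟨hg.aestronglyMeasurable, (hbound u h).trans_lt hC.lt_top⟩
  have hzero : ∀ u (h : Fin u → Round N K 𝓜), ∫ r, g r ∂stepKernel s ν u h = 0 := by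
    intro u h
    have hi := hint u h
    unfold stepKernel at hi ⊢
    rw [integral_compProd hi]
    refine (integral_congr_ae (ae_of_all _ fun q => ?_)).trans (integral_zero _ _)
    change ∫ x, (roundLogRatio ν ν' (q, x) - roundInfo ν ν' q.2) ∂ν.rewardKernel q.2 = 0
    rw [integral_sub (integrable_roundLogRatio ν ν' q) (integrable_const _),
      integral_roundLogRatio]
    simp
  obtain ⟨h1, h2⟩ := integral_sum_rounds_eq_zero s ν hg hC hbound hzero t
  have h3 := integrable_sum_arms s ν t (roundInfo ν ν')
  have e : (fun h : Fin t → Round N K 𝓜 => ∑ u, roundLogRatio ν ν' (h u)) =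
      fun h => ∑ u, g (h u) + ∑ u, roundInfo ν ν' (h u).1.2 := by
    ext h; simp [hg_def]
  rw [e]
  exact ⟨h1.add h3, by rw [integral_add h1 h3, h2, zero_add]⟩

/-! ### A testing inequality -/

/-- A two-point testing inequality in the style of Bretagnolle and Huber. -/
theorem exp_neg_le_testing_error {Ω : Type*} [MeasurableSpace Ω] {P Q : Measure Ω}
    [IsProbabilityMeasure P] [IsProbabilityMeasure Q] {L : Ω → ℝ} (hL : Measurable L)
    (hLi : Integrable L P)
    (hQ : ∀ s, MeasurableSet s → Q s = ∫⁻ ω in s, ENNReal.ofReal (Real.exp (-L ω)) ∂P)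
    {A : Set Ω} (hA : MeasurableSet A) :
    Real.exp (-(∫ ω, L ω ∂P + 1)) ≤ P.real A + Q.real Aᶜ := by
  have hm : Measurable fun ω => Real.exp (-L ω) := hL.neg.exp
  have hexp : Integrable (fun ω => Real.exp (-L ω)) P := by
    refine ⟨hm.aestronglyMeasurable, ?_⟩
    rw [hasFiniteIntegral_iff_ofReal (ae_of_all _ fun ω => (Real.exp_pos _).le),
      ← setLIntegral_univ, ← hQ _ MeasurableSet.univ]
    exact measure_lt_top _ _
  have hset : ∀ s, MeasurableSet s → ∫ ω in s, Real.exp (-L ω) ∂P = Q.real s := fun s hs => by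
    rw [integral_eq_lintegral_of_nonneg_ae (ae_of_all _ fun ω => (Real.exp_pos _).le)
      hm.aestronglyMeasurable, ← hQ s hs, Measure.real]
  have hone : ∫ ω, Real.exp (-L ω) ∂P = 1 := by
    rw [← setIntegral_univ, hset _ MeasurableSet.univ]; simp
  set c := ∫ ω, L ω ∂P + 1 with hc
  -- Tangent line bounds at the point `c` for `min 1 (exp (-L))`, where the positive part of `L`
  -- is at most `L + exp (-L)`.
  have key : ∀ y : ℝ, Real.exp (-c) * (1 + c - y - Real.exp (-y)) ≤ min 1 (Real.exp (-y)) := by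
    intro y
    have h1 := Real.add_one_le_exp (c - max y 0)
    have h2 : max y 0 ≤ y + Real.exp (-y) := by
      have := Real.add_one_le_exp (-y)
      exact max_le (by linarith [Real.exp_pos (-y)]) (by linarith)
    have h3 : Real.exp (-c) * Real.exp (c - max y 0) ≤ min 1 (Real.exp (-y)) := by
      rw [← Real.exp_add]
      refine le_min (Real.exp_le_one_iff.2 ?_) (Real.exp_le_exp.2 ?_)
      · linarith [le_max_right y 0]
      · linarith [le_max_left y 0]
    exact (mul_le_mul_of_nonneg_left (by linarith) (Real.exp_pos _).le).trans h3
  have hsub : Integrable (fun ω => 1 + c - L ω) P := (integrable_const _).sub hLi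
  have hlin : Integrable (fun ω => Real.exp (-c) * (1 + c - L ω - Real.exp (-L ω))) P :=
    (hsub.sub hexp).const_mul _
  have hval : ∫ ω, Real.exp (-c) * (1 + c - L ω - Real.exp (-L ω)) ∂P = Real.exp (-c) := by
    rw [integral_const_mul, integral_sub hsub hexp,
      integral_sub (integrable_const _) hLi, hone]
    simp [hc]
    ring
  rw [← hval, ← integral_add_compl hA hlin]
  refine add_le_add ?_ ?_
  · calc ∫ ω in A, Real.exp (-c) * (1 + c - L ω - Real.exp (-L ω)) ∂P
        ≤ ∫ _ in A, (1 : ℝ) ∂P :=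
          setIntegral_mono hlin.integrableOn (integrable_const _).integrableOn
            fun ω => (key _).trans (min_le_left _ _)
      _ = P.real A := by simp
  · rw [← hset _ hA.compl]
    exact setIntegral_mono hlin.integrableOn hexp.integrableOn
      fun ω => (key _).trans (min_le_right _ _)

end GroupBandit

/-! ### Regret and numbers of pulls -/

namespace GroupBandit

variable {N M K : ℕ} {𝓜 : Type*}

/-- The number of agents assigned to bandit `m` that pull arm `k` when the agents pull the
arms `a`. -/
def armPulls (c : Fin N → Fin M) (m : Fin M) (k : Fin K) (a : Fin N → Fin K) : ℝ :=
  ∑ i, if c i = m ∧ a i = k then 1 else 0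

/-- The number of pulls of arm `k` of bandit `m` in a history, by all agents together. -/
def totalPulls (c : Fin N → Fin M) (m : Fin M) (k : Fin K) {T : ℕ}
    (h : Fin T → Round N K 𝓜) : ℝ :=
  ∑ u, armPulls c m k (h u).1.2

theorem gap_pos (ν : BanditInstance N M K) {m : Fin M} {k : Fin K} (hk : k ≠ ν.best m) :
    0 < ν.gap m k := sub_pos.2 (ν.best_lt m k hk)

theorem gap_nonneg (ν : BanditInstance N M K) (m : Fin M) (k : Fin K) : 0 ≤ ν.gap m k := by
  by_cases hk : k = ν.best m
  · simp [BanditInstance.gap, hk]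
  · exact (gap_pos ν hk).le

theorem armPulls_nonneg (c : Fin N → Fin M) (m : Fin M) (k : Fin K) (a : Fin N → Fin K) :
    0 ≤ armPulls c m k a :=
  Finset.sum_nonneg fun i _ => by split_ifs <;> norm_num

theorem totalPulls_nonneg (c : Fin N → Fin M) (m : Fin M) (k : Fin K) {T : ℕ}
    (h : Fin T → Round N K 𝓜) : 0 ≤ totalPulls c m k h :=
  Finset.sum_nonneg fun _ _ => armPulls_nonneg _ _ _ _

theorem groupRegret_nonneg (ν : BanditInstance N M K) {T : ℕ} (h : Fin T → Round N K 𝓜) :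
    0 ≤ groupRegret ν h :=
  Finset.sum_nonneg fun _ _ => Finset.sum_nonneg fun _ _ => gap_nonneg _ _ _

theorem groupRegret_eq_sum_totalPulls (ν : BanditInstance N M K) {T : ℕ}
    (h : Fin T → Round N K 𝓜) :
    groupRegret ν h =
      ∑ m, ∑ k ∈ Finset.univ.erase (ν.best m), ν.gap m k * totalPulls ν.assign m k h := by
  have hone : ∀ (c : Fin M) (a : Fin K), ν.gap c a =
      ∑ m, ∑ k ∈ Finset.univ.erase (ν.best m),
        ν.gap m k * if c = m ∧ a = k then 1 else 0 := by
    intro c a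
    have : ∀ m, ∑ k ∈ Finset.univ.erase (ν.best m), ν.gap m k * (if c = m ∧ a = k then 1 else 0)
        = if c = m then ν.gap m a else 0 := by
      intro m
      rw [Finset.sum_erase _ (by simp [BanditInstance.gap])]
      by_cases hc : c = m <;> simp [hc]
    simp_rw [this]
    simp
  unfold groupRegret totalPulls armPulls
  simp_rw [Finset.mul_sum]
  rw [Finset.sum_comm]
  calc ∑ u, ∑ i, ν.gap (ν.assign i) ((h u).1.2 i)
      = ∑ u, ∑ i, ∑ m, ∑ k ∈ Finset.univ.erase (ν.best m),
          ν.gap m k * (if ν.assign i = m ∧ (h u).1.2 i = k then 1 else 0) :=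
        Finset.sum_congr rfl fun u _ => Finset.sum_congr rfl fun i _ => hone _ _
    _ = ∑ u, ∑ m, ∑ k ∈ Finset.univ.erase (ν.best m), ∑ i,
          ν.gap m k * (if ν.assign i = m ∧ (h u).1.2 i = k then 1 else 0) := by
        refine Finset.sum_congr rfl fun u _ => ?_
        rw [Finset.sum_comm]
        exact Finset.sum_congr rfl fun m _ => Finset.sum_comm
    _ = _ := by
        rw [Finset.sum_comm]
        exact Finset.sum_congr rfl fun m _ => Finset.sum_comm

theorem gap_mul_totalPulls_le_groupRegret (ν : BanditInstance N M K) {m : Fin M} {k : Fin K}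
    (hk : k ≠ ν.best m) {T : ℕ} (h : Fin T → Round N K 𝓜) :
    ν.gap m k * totalPulls ν.assign m k h ≤ groupRegret ν h := by
  have hnn : ∀ m k, 0 ≤ ν.gap m k * totalPulls ν.assign m k h := fun m k =>
    mul_nonneg (gap_nonneg ν m k) (totalPulls_nonneg _ _ _ _)
  rw [groupRegret_eq_sum_totalPulls]
  exact (Finset.single_le_sum (f := fun k => ν.gap m k * totalPulls ν.assign m k h)
    (fun k _ => hnn m k) (Finset.mem_erase.2 ⟨hk, Finset.mem_univ _⟩)).trans
    (Finset.single_le_sum (f := fun m => ∑ k ∈ Finset.univ.erase (ν.best m),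
      ν.gap m k * totalPulls ν.assign m k h)
      (fun m _ => Finset.sum_nonneg fun k _ => hnn m k) (Finset.mem_univ m))

/-- The alternative instance in which the suboptimal arm `k` of bandit `m` is raised to a mean that
is larger by `ε` than that of the best arm. -/
def BanditInstance.raiseArm (ν : BanditInstance N M K) (m : Fin M) (k : Fin K)
    (ε : ℝ) (hε : 0 < ε) : BanditInstance N M K where
  mean m' k' := if m' = m ∧ k' = k then ν.mean m (ν.best m) + ε else ν.mean m' k'
  assign := ν.assign
  best := Function.update ν.best m k
  best_lt m' k' hk' := by
    by_cases hm : m' = m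
    · subst hm
      simp only [Function.update_self] at hk'
      simp only [Function.update_self, hk', and_false, if_false, and_self, if_true]
      by_cases hb : k' = ν.best m'
      · rw [hb]; linarith
      · linarith [ν.best_lt m' k' hb]
    · simp only [Function.update_of_ne hm] at hk' ⊢
      simpa [hm] using ν.best_lt m' k' hk'

section raiseArm

variable (ν : BanditInstance N M K) (m : Fin M) (k : Fin K) (ε : ℝ) (hε : 0 < ε)

theorem raiseArm_gap_ge {k' : Fin K} (hk' : k' ≠ k) : ε ≤ (ν.raiseArm m k ε hε).gap m k' := by
  have : ν.mean m k' ≤ ν.mean m (ν.best m) := by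
    linarith [gap_nonneg ν m k', show ν.gap m k' = ν.mean m (ν.best m) - ν.mean m k' from rfl]
  simp only [BanditInstance.gap, BanditInstance.raiseArm, Function.update_self, hk', and_false,
    if_false, and_self, if_true]
  linarith

theorem roundInfo_raiseArm (a : Fin N → Fin K) :
    roundInfo ν (ν.raiseArm m k ε hε) a =
      (ν.gap m k + ε) ^ 2 / 2 * armPulls ν.assign m k a := by
  unfold roundInfo armPulls
  rw [Finset.mul_sum]
  refine Finset.sum_congr rfl fun i _ => ?_
  by_cases h : ν.assign i = m ∧ a i = k
  · simp only [BanditInstance.raiseArm, BanditInstance.gap, h, and_self, if_true]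
    ring
  · simp [BanditInstance.raiseArm, h]

/-- A single agent of bandit `m` already makes the regret on the raised instance large if arm `k`
is pulled rarely. -/
theorem mul_sub_totalPulls_le_groupRegret_raiseArm (hm : ∃ i, ν.assign i = m) {T : ℕ}
    (h : Fin T → Round N K 𝓜) :
    ε * (T - totalPulls ν.assign m k h) ≤ groupRegret (ν.raiseArm m k ε hε) h := by
  obtain ⟨i, hi⟩ := hm
  set ν' := ν.raiseArm m k ε hε with hν'
  have hi' : ν'.assign i = m := hi
  have hu : ∀ u, ε * (1 - armPulls ν.assign m k (h u).1.2) ≤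
      ν'.gap (ν'.assign i) ((h u).1.2 i) := by
    intro u
    by_cases hk : (h u).1.2 i = k
    · have h1 : (1 : ℝ) ≤ armPulls ν.assign m k (h u).1.2 := by
        have := Finset.single_le_sum
          (f := fun i => if ν.assign i = m ∧ (h u).1.2 i = k then (1 : ℝ) else 0)
          (fun i _ => by split_ifs <;> norm_num) (Finset.mem_univ i)
        rwa [if_pos ⟨hi, hk⟩] at this
      exact (mul_nonpos_of_nonneg_of_nonpos hε.le (by linarith)).trans (gap_nonneg _ _ _)
    · rw [hi']
      refine le_trans ?_ (raiseArm_gap_ge ν m k ε hε hk)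
      nlinarith [armPulls_nonneg ν.assign m k (h u).1.2]
  calc ε * (T - totalPulls ν.assign m k h)
      = ∑ u, ε * (1 - armPulls ν.assign m k (h u).1.2) := by
        rw [← Finset.mul_sum, Finset.sum_sub_distrib]; simp [totalPulls]
    _ ≤ ∑ u, ν'.gap (ν'.assign i) ((h u).1.2 i) := Finset.sum_le_sum fun u _ => hu u
    _ ≤ groupRegret ν' h :=
        Finset.single_le_sum (f := fun i => ∑ u, ν'.gap (ν'.assign i) ((h u).1.2 i))
          (fun _ _ => Finset.sum_nonneg fun _ _ => gap_nonneg _ _ _) (Finset.mem_univ i)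

theorem raiseArm_mem_problemClass {J : Set ℝ} (hJ : J.OrdConnected) {𝒜 : Set (Fin N → Fin M)}
    (hν : ν ∈ problemClass J 𝒜) {y : ℝ} (hy : y ∈ J) (hεy : ν.mean m (ν.best m) + ε ≤ y) :
    ν.raiseArm m k ε hε ∈ problemClass J 𝒜 := by
  refine ⟨fun m' k' => ?_, hν.2⟩
  simp only [BanditInstance.raiseArm]
  split_ifs
  · exact hJ.out (hν.1 m (ν.best m)) hy ⟨by linarith, hεy⟩
  · exact hν.1 m' k'

end raiseArm

/-! ### The lower bound for the pulls of one arm -/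

variable [MeasurableSpace 𝓜]

theorem measurable_totalPulls (c : Fin N → Fin M) (m : Fin M) (k : Fin K) {T : ℕ} :
    Measurable (totalPulls (𝓜 := 𝓜) (T := T) c m k) :=
  Finset.measurable_fun_sum _ fun u _ =>
    (measurable_arms (armPulls c m k)).comp (measurable_pi_apply u)

theorem integrable_totalPulls (s : Strategy N K 𝓜) (ν : BanditInstance N M K) (T : ℕ)
    (c : Fin N → Fin M) (m : Fin M) (k : Fin K) :
    Integrable (totalPulls (T := T) c m k) (law s ν T) :=
  integrable_sum_arms s ν T (armPulls c m k)

theorem integrable_groupRegret (s : Strategy N K 𝓜) (ν ν' : BanditInstance N M K) (T : ℕ) :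
    Integrable (groupRegret (T := T) ν) (law s ν' T) := by
  have := integrable_sum_arms s ν' T fun a => ∑ i, ν.gap (ν.assign i) (a i)
  unfold groupRegret
  simpa only [Finset.sum_comm (s := (Finset.univ : Finset (Fin N)))] using this

/-- The expected number of pulls of arm `k` of bandit `m`. -/
noncomputable def expectedPulls (π : Policy N M K 𝓜) (ν : BanditInstance N M K) (T : ℕ)
    (m : Fin M) (k : Fin K) : ℝ :=
  ∫ h, totalPulls ν.assign m k h ∂law (π T ν.assign) ν T

theorem expectedRegret_eq_sum_expectedPulls (π : Policy N M K 𝓜) (ν : BanditInstance N M K)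
    (T : ℕ) : expectedRegret π ν T =
      ∑ m, ∑ k ∈ Finset.univ.erase (ν.best m), ν.gap m k * expectedPulls π ν T m k := by
  unfold expectedRegret expectedPulls
  simp_rw [groupRegret_eq_sum_totalPulls]
  have hi : ∀ m k, Integrable (fun h : Fin T → Round N K 𝓜 =>
      ν.gap m k * totalPulls ν.assign m k h) (law (π T ν.assign) ν T) := fun m k =>
    (integrable_totalPulls _ _ _ _ m k).const_mul _
  rw [integral_finsetSum _ fun m _ => integrable_finsetSum _ fun k _ => hi m k]
  refine Finset.sum_congr rfl fun m _ => ?_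
  rw [integral_finsetSum _ fun k _ => hi m k]
  exact Finset.sum_congr rfl fun k _ => integral_const_mul _ _

/-- The non-asymptotic trade-off: few expected pulls of arm `k` force a large regret on the given
instance or on the raised one. The event that separates them is that arm `k` is pulled at least
`T / 2` times. -/
theorem exp_neg_pulls_le_regret (π : Policy N M K 𝓜) (ν : BanditInstance N M K) {m : Fin M}
    {k : Fin K} (hk : k ≠ ν.best m) (hm : ∃ i, ν.assign i = m) {ε : ℝ} (hε : 0 < ε) {T : ℕ}
    (hT : 0 < T) :
    Real.exp (-((ν.gap m k + ε) ^ 2 / 2 * expectedPulls π ν T m k + 1)) ≤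
      2 / T * (expectedRegret π ν T / ν.gap m k +
        expectedRegret π (ν.raiseArm m k ε hε) T / ε) := by
  set ν' := ν.raiseArm m k ε hε with hν'
  set s := π T ν.assign with hs
  have hΔ := gap_pos ν hk
  have hT' : (0 : ℝ) < T := by exact_mod_cast hT
  obtain ⟨hLi, hL⟩ := integral_sum_roundLogRatio s ν ν' T
  have hinfo : ∫ h, ∑ u, roundInfo ν ν' (h u).1.2 ∂law s ν T =
      (ν.gap m k + ε) ^ 2 / 2 * expectedPulls π ν T m k := by
    simp_rw [hν', roundInfo_raiseArm, ← Finset.mul_sum]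
    exact integral_const_mul _ _
  set A : Set (Fin T → Round N K 𝓜) := {h | (T : ℝ) ≤ 2 * totalPulls ν.assign m k h} with hA_def
  have hA : MeasurableSet A :=
    measurableSet_le measurable_const ((measurable_totalPulls _ _ _).const_mul 2)
  have htest := exp_neg_le_testing_error (P := law s ν T) (Q := law s ν' T)
    (measurable_sum_rounds (measurable_roundLogRatio ν ν')) hLi (fun S hS => by
      have := lintegral_law_change s ν ν' T (f := S.indicator 1) (measurable_one.indicator hS)
      rw [lintegral_indicator_one hS] at this
      rw [this, ← lintegral_indicator hS]
      refine lintegral_congr fun h => ?_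
      by_cases hh : h ∈ S <;> simp [hh]) hA
  rw [hL, hinfo] at htest
  have hP : ν.gap m k * T / 2 * (law s ν T).real A ≤ expectedRegret π ν T := by
    refine le_trans ?_ (mul_meas_ge_le_integral_of_nonneg (ε := ν.gap m k * T / 2)
      (ae_of_all _ fun h => groupRegret_nonneg ν h) (integrable_groupRegret s ν ν T))
    refine mul_le_mul_of_nonneg_left (measureReal_mono fun h hh => ?_) (by positivity)
    have h1 := gap_mul_totalPulls_le_groupRegret ν hk h
    have h2 : (T : ℝ) ≤ 2 * totalPulls ν.assign m k h := hh
    change ν.gap m k * T / 2 ≤ groupRegret ν h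
    nlinarith
  have hQ : ε * T / 2 * (law s ν' T).real Aᶜ ≤ expectedRegret π ν' T := by
    refine le_trans ?_ (mul_meas_ge_le_integral_of_nonneg (ε := ε * T / 2)
      (ae_of_all _ fun h => groupRegret_nonneg ν' h) (integrable_groupRegret s ν' ν' T))
    refine mul_le_mul_of_nonneg_left (measureReal_mono fun h hh => ?_) (by positivity)
    have h1 := mul_sub_totalPulls_le_groupRegret_raiseArm ν m k ε hε hm h
    have h2 : 2 * totalPulls ν.assign m k h < T := not_le.1 hh
    change ε * T / 2 ≤ groupRegret ν' h
    nlinarith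
  have hP' : (law s ν T).real A ≤ 2 / T * (expectedRegret π ν T / ν.gap m k) := by
    rw [div_mul_div_comm, le_div_iff₀ (by positivity)]; linarith
  have hQ' : (law s ν' T).real Aᶜ ≤ 2 / T * (expectedRegret π ν' T / ε) := by
    rw [div_mul_div_comm, le_div_iff₀ (by positivity)]; linarith
  rw [mul_add]
  exact htest.trans (add_le_add hP' hQ')

/-- Under a uniformly efficient policy, arm `k` of bandit `m` is pulled at least
`(2 / Δ ^ 2 - o(1)) log T` times. -/
theorem eventually_expectedPulls_ge {J : Set ℝ} (hJ : J.OrdConnected) {𝒜 : Set (Fin N → Fin M)}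
    {π : Policy N M K 𝓜} (hπ : UniformlyEfficient J 𝒜 π) {ν : BanditInstance N M K}
    (hν : ν ∈ problemClass J 𝒜) {m : Fin M} {k : Fin K} (hk : k ≠ ν.best m)
    (hm : ∃ i, ν.assign i = m) (hbest : ∃ y ∈ J, ν.mean m (ν.best m) < y)
    {a : ℝ} (ha : a < 2 / ν.gap m k ^ 2) :
    ∀ᶠ T : ℕ in atTop, a * Real.log T ≤ expectedPulls π ν T m k := by
  obtain ⟨y, hyJ, hy⟩ := hbest
  have hΔ := gap_pos ν hk
  -- One small `ε` serves as the excess of the raised arm and as the exponent of the regret bound.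
  obtain ⟨ε, hεa, hε0, hε1, hεy⟩ : ∃ ε : ℝ, a < (1 - 2 * ε) * (2 / (ν.gap m k + ε) ^ 2) ∧
      0 < ε ∧ ε < 1 ∧ ε < y - ν.mean m (ν.best m) := by
    have hcont : ContinuousAt (fun ε : ℝ => (1 - 2 * ε) * (2 / (ν.gap m k + ε) ^ 2)) 0 := by
      refine ContinuousAt.mul (by fun_prop) (ContinuousAt.div (by fun_prop) (by fun_prop) ?_)
      simpa using hΔ.ne'
    have h1 : ∀ᶠ ε in 𝓝[>] (0 : ℝ), a < (1 - 2 * ε) * (2 / (ν.gap m k + ε) ^ 2) :=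
      (hcont.eventually (lt_mem_nhds (by simpa using ha))).filter_mono nhdsWithin_le_nhds
    have h2 : ∀ b : ℝ, 0 < b → ∀ᶠ ε in 𝓝[>] (0 : ℝ), ε < b := fun b hb =>
      (eventually_lt_nhds hb).filter_mono nhdsWithin_le_nhds
    exact (h1.and (eventually_mem_nhdsWithin.and ((h2 1 one_pos).and (h2 _ (sub_pos.2 hy))))).exists
  have hν' := raiseArm_mem_problemClass ν m k ε hε0 hJ hν hyJ (by linarith)
  have hR := ((hπ ν hν ε hε0 hε1).const_mul_left (ν.gap m k)⁻¹).add
    ((hπ _ hν' ε hε0 hε1).const_mul_left ε⁻¹)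
  have hlog : ∀ᶠ T : ℕ in atTop, Real.log 2 + 1 ≤ ε * Real.log T :=
    ((Real.tendsto_log_atTop.comp tendsto_natCast_atTop_atTop).const_mul_atTop hε0).eventually_ge_atTop
      _
  filter_upwards [hR.bound one_pos, hlog, eventually_gt_atTop 1] with T hRT hlogT hT
  have hT' : (0 : ℝ) < T := by exact_mod_cast one_pos.trans hT
  have hlogpos : 0 < Real.log T := Real.log_pos (by exact_mod_cast hT)
  have hsum : expectedRegret π ν T / ν.gap m k +
      expectedRegret π (ν.raiseArm m k ε hε0) T / ε ≤ (T : ℝ) ^ ε := by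
    rw [one_mul, Real.norm_of_nonneg (Real.rpow_nonneg hT'.le _)] at hRT
    refine le_trans (le_of_eq ?_) ((Real.le_norm_self _).trans hRT)
    simp only [div_eq_inv_mul]
  have hmain := (exp_neg_pulls_le_regret π ν hk hm hε0 (one_pos.trans hT)).trans
    (mul_le_mul_of_nonneg_left hsum (by positivity))
  have hlogmain := Real.log_le_log (Real.exp_pos _) hmain
  rw [Real.log_exp, Real.log_mul (by positivity) (by positivity), Real.log_div (by norm_num) hT'.ne',
    Real.log_rpow hT'] at hlogmain
  have hd : 0 < (ν.gap m k + ε) ^ 2 := by positivity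
  have hE : (1 - 2 * ε) * Real.log T ≤ (ν.gap m k + ε) ^ 2 / 2 * expectedPulls π ν T m k := by
    linarith
  calc a * Real.log T ≤ (1 - 2 * ε) * (2 / (ν.gap m k + ε) ^ 2) * Real.log T :=
        mul_le_mul_of_nonneg_right hεa.le hlogpos.le
    _ = 2 / (ν.gap m k + ε) ^ 2 * ((1 - 2 * ε) * Real.log T) := by ring
    _ ≤ 2 / (ν.gap m k + ε) ^ 2 * ((ν.gap m k + ε) ^ 2 / 2 * expectedPulls π ν T m k) :=
        mul_le_mul_of_nonneg_left hE (by positivity)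
    _ = expectedPulls π ν T m k := by field_simp

end GroupBandit

/-! ### Summation over the bandits and arms -/

theorem theorem3 {N M K : ℕ} {𝓜 : Type*} [MeasurableSpace 𝓜]
    (J : Set ℝ) (hJ : J.OrdConnected) (𝒜 : Set (Fin N → Fin M))
    (π : GroupBandit.Policy N M K 𝓜) (hπ : GroupBandit.UniformlyEfficient J 𝒜 π)
    (ν : GroupBandit.BanditInstance N M K) (hν : ν ∈ GroupBandit.problemClass J 𝒜)
    (hsurj : Function.Surjective ν.assign)
    (hbest : ∀ m, ∃ y ∈ J, ν.mean m (ν.best m) < y) :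
    ((∑ m : Fin M, ∑ k ∈ Finset.univ.erase (ν.best m), 2 / ν.gap m k : ℝ) : EReal) ≤
      liminf (fun T : ℕ =>
        ((GroupBandit.expectedRegret π ν T / Real.log (T : ℝ) : ℝ) : EReal)) atTop := by
  set S : ℝ := ∑ m : Fin M, ∑ k ∈ Finset.univ.erase (ν.best m), 2 / ν.gap m k with hS
  have hpos : ∀ m, ∀ k ∈ Finset.univ.erase (ν.best m), 0 < ν.gap m k := fun m k hk =>
    GroupBandit.gap_pos ν (Finset.ne_of_mem_erase hk)
  have key : ∀ ε : ℝ, 0 < ε → (((1 - ε) * S : ℝ) : EReal) ≤ liminf (fun T : ℕ =>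
      ((GroupBandit.expectedRegret π ν T / Real.log (T : ℝ) : ℝ) : EReal)) atTop := by
    intro ε hε
    have hev : ∀ᶠ T : ℕ in atTop, ∀ m, ∀ k ∈ Finset.univ.erase (ν.best m),
        (1 - ε) * (2 / ν.gap m k ^ 2) * Real.log T ≤ GroupBandit.expectedPulls π ν T m k := by
      refine eventually_all.2 fun m => (Finset.eventually_all _).2 fun k hk => ?_
      have hΔ := hpos m k hk
      have h0 : 0 < 2 / ν.gap m k ^ 2 := by positivity
      exact GroupBandit.eventually_expectedPulls_ge hJ hπ hν (Finset.ne_of_mem_erase hk) (hsurj m)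
        (hbest m) (by nlinarith)
    refine le_liminf_of_le (by isBoundedDefault) ?_
    filter_upwards [hev, eventually_gt_atTop 1] with T hT hT1
    rw [EReal.coe_le_coe_iff, le_div_iff₀ (Real.log_pos (by exact_mod_cast hT1)),
      GroupBandit.expectedRegret_eq_sum_expectedPulls, hS, Finset.mul_sum, Finset.sum_mul]
    refine Finset.sum_le_sum fun m _ => ?_
    rw [Finset.mul_sum, Finset.sum_mul]
    refine Finset.sum_le_sum fun k hk => ?_
    have hΔ := hpos m k hk
    calc (1 - ε) * (2 / ν.gap m k) * Real.log T
        = ν.gap m k * ((1 - ε) * (2 / ν.gap m k ^ 2) * Real.log T) := by field_simp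
      _ ≤ _ := mul_le_mul_of_nonneg_left (hT m k hk) hΔ.le
  have hlim : Tendsto (fun ε : ℝ => (((1 - ε) * S : ℝ) : EReal)) (𝓝[>] 0) (𝓝 (S : EReal)) := by
    have hc : Continuous fun ε : ℝ => (((1 - ε) * S : ℝ) : EReal) :=
      continuous_coe_real_ereal.comp (by fun_prop)
    simpa using (hc.tendsto 0).mono_left nhdsWithin_le_nhds
  exact le_of_tendsto hlim (eventually_mem_nhdsWithin.mono fun ε hε => key ε hε)
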